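/- Let $(X,\tau)$ be a real vector lattice with a Hausdorff linear topology $\tau$ that is locally convex and locally solid (it has a base of neighbourhoods of $0$ consisting of solid sets, where $S$ is solid if $|x|\le|y|$ and $y\in S$ imply $x\in S$), and suppose that $(X,\tau)$ is topologically complete (every $\tau$-Cauchy net $\tau$-converges). Suppose that $X$ has the Banach–Saks property LSBSP: every $\tau$-bounded sequence $(x_n)$ in $X$ has a subsequence $(x_{n_k})$ whose Cesàro means $\frac1n\sum_{k=1}^n x_{n_k}$ are $\tau$-convergent. Then: (a) $X$ has the Lebesgue property: for every net $(u_\alpha)$ in $X$, $u_\alpha\downarrow 0$ implies $u_\alpha\xrightarrow{\tau}0$; (b) $X$ has the Levi property: every non-empty $\tau$-bounded upward directed subset of $X_+$ has a supremum in $X$. -/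

import Mathlib

open Filter Topology

universe u v

/-- The topology of a vector lattice is *locally solid* if the solid neighbourhoods of zero form a
local basis at zero. (That the topology is a linear one is recorded separately by
`IsUniformAddGroup` / `IsTopologicalAddGroup` and `ContinuousSMul ℝ X`.) -/
class IsLocallySolid (X : Type u) [AddCommGroup X] [Lattice X] [TopologicalSpace X] : Prop where
  hasBasis_solid : (𝓝 (0 : X)).HasBasis
    (fun s : Set X => s ∈ 𝓝 (0 : X) ∧ LatticeOrderedAddCommGroup.IsSolid s) id

/-- Banach-Saks property: every topologically bounded sequence has a subsequence whose
Cesàro means converge. -/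
def HasLSBSP (X : Type u) [AddCommGroup X] [Module ℝ X] [TopologicalSpace X] : Prop :=
  ∀ x : ℕ → X, Bornology.IsVonNBounded ℝ (Set.range x) →
    ∃ φ : ℕ → ℕ, StrictMono φ ∧ ∃ y : X,
      Tendsto (fun n : ℕ => (n : ℝ)⁻¹ • ∑ k ∈ Finset.range n, x (φ k)) atTop (𝓝 y)

/-- Lebesgue property: every net decreasing to `0` in order converges to `0` topologically.
The index sets range over the universe `v`. -/
def HasLebesgueProperty (X : Type u) [AddCommGroup X] [Lattice X] [TopologicalSpace X] : Prop :=
  ∀ (ι : Type v) [Preorder ι] [IsDirectedOrder ι] [Nonempty ι] (x : ι → X),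
    Antitone x → IsGLB (Set.range x) 0 → Tendsto x atTop (𝓝 0)

/-- Levi property: every (nonempty) topologically bounded upward directed set of positive elements
has a supremum. -/
def HasLeviProperty (X : Type u) [AddCommGroup X] [Module ℝ X] [Lattice X]
    [TopologicalSpace X] : Prop :=
  ∀ D : Set X, D.Nonempty → (∀ x ∈ D, 0 ≤ x) → DirectedOn (· ≤ ·) D →
    Bornology.IsVonNBounded ℝ D → ∃ s : X, IsLUB D s

section LocallySolid

variable {X : Type u} [AddCommGroup X] [Lattice X] [IsOrderedAddMonoid X]

/-! Let `z` be an increasing subsequence whose Cesàro means tend to `y`. Then mean ≤ `z n` ≤ `y`, so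
`y - z n` is squeezed to 0 by solidity: every bounded increasing sequence converges
(`HasLSBSP.exists_tendsto_of_monotone`). By completeness this passes to nets
(`HasLSBSP.exists_tendsto_net`), since a monotone net that is not Cauchy contains an increasing
sequence whose jumps avoid a fixed neighbourhood of 0. As the cone is closed, limits of monotone
nets are order bounds, which yields both properties. -/

/-- In a locally solid group, positive elements dominated by a null family form a null family. -/
theorem IsLocallySolid.tendsto_zero_of_le [TopologicalSpace X] [IsLocallySolid X] {α : Type*}
    {l : Filter α} {f g : α → X} (hg : Tendsto g l (𝓝 0)) (h0 : ∀ᶠ a in l, 0 ≤ f a)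
    (hfg : ∀ᶠ a in l, f a ≤ g a) : Tendsto f l (𝓝 0) := by
  rw [(IsLocallySolid.hasBasis_solid (X := X)).tendsto_right_iff]
  rintro U ⟨hU, hs⟩
  filter_upwards [h0, hfg, hg hU] with a h1 h2 h3
  refine hs h3 ?_
  rw [abs_of_nonneg h1, abs_of_nonneg (h1.trans h2)]
  exact h2

/-- Every `y ≥ 0` satisfies `x⁻ ≤ |y - x|`; letting `y` tend to `x` forces the constant `x⁻` to be
0. -/
theorem IsLocallySolid.isClosed_nonneg [TopologicalSpace X] [IsTopologicalAddGroup X] [T2Space X]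
    [IsLocallySolid X] : IsClosed {x : X | 0 ≤ x} := by
  refine isClosed_of_closure_subset fun x hx => ?_
  have := mem_closure_iff_nhdsWithin_neBot.1 hx
  have hsub : Tendsto (fun y : X => y - x) (𝓝[{x : X | 0 ≤ x}] x) (𝓝 0) := by
    have hid : Tendsto (fun y : X => y) (𝓝[{x : X | 0 ≤ x}] x) (𝓝 x) := nhdsWithin_le_nhds
    simpa using hid.sub_const x
  have habs : Tendsto (fun y : X => |y - x|) (𝓝[{x : X | 0 ≤ x}] x) (𝓝 0) := by
    rw [(IsLocallySolid.hasBasis_solid (X := X)).tendsto_right_iff]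
    rintro U ⟨hU, hs⟩
    filter_upwards [hsub hU] with y hy
    exact hs hy (abs_abs _).le
  have hneg : Tendsto (fun _ : X => x⁻) (𝓝[{x : X | 0 ≤ x}] x) (𝓝 0) := by
    refine IsLocallySolid.tendsto_zero_of_le habs (.of_forall fun _ => negPart_nonneg x) ?_
    filter_upwards [self_mem_nhdsWithin] with y hy
    refine sup_le ?_ (abs_nonneg _)
    calc -x ≤ y - x := by simpa [sub_eq_add_neg] using hy
      _ ≤ |y - x| := le_abs_self _
  exact negPart_eq_zero.1 (tendsto_nhds_unique tendsto_const_nhds hneg)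

theorem IsLocallySolid.orderClosedTopology [TopologicalSpace X] [IsTopologicalAddGroup X]
    [T2Space X] [IsLocallySolid X] : OrderClosedTopology X where
  isClosed_le' := by
    have h := (IsLocallySolid.isClosed_nonneg (X := X)).preimage
      (continuous_snd.sub continuous_fst : Continuous fun p : X × X => p.2 - p.1)
    simpa [Set.preimage] using h

/-- Order intervals of a locally solid vector lattice are bounded. -/
theorem IsLocallySolid.isVonNBounded_Icc [TopologicalSpace X] [Module ℝ X] [IsOrderedModule ℝ X]
    [ContinuousSMul ℝ X] [IsLocallySolid X] (b : X) :
    Bornology.IsVonNBounded ℝ (Set.Icc 0 b) := by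
  rw [(IsLocallySolid.hasBasis_solid (X := X)).isVonNBounded_iff]
  rintro U ⟨hU, hs⟩
  have hb : Absorbs ℝ U {b} := Bornology.isVonNBounded_singleton b hU
  filter_upwards [hb, Bornology.eventually_ne_cobounded (0 : ℝ)] with r hr hr0
  rintro y ⟨hy0, hyb⟩
  rw [Set.singleton_subset_iff, Set.mem_smul_set_iff_inv_smul_mem₀ hr0] at hr
  rw [Set.mem_smul_set_iff_inv_smul_mem₀ hr0]
  refine hs hr ?_
  have key : ∀ c : ℝ, 0 ≤ c → |c • y| ≤ |c • b| := fun c hc => by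
    rw [abs_of_nonneg (smul_nonneg hc hy0), abs_of_nonneg (smul_nonneg hc (hy0.trans hyb))]
    exact smul_le_smul_of_nonneg_left hyb hc
  rcases le_total 0 r⁻¹ with h | h
  · exact key _ h
  · simpa using key (-r⁻¹) (neg_nonneg.2 h)

/-- A monotone sequence is dominated by the limit of its Cesàro means. -/
theorem Monotone.le_of_tendsto_cesaro [TopologicalSpace X] [IsTopologicalAddGroup X] [Module ℝ X]
    [IsOrderedModule ℝ X] [ContinuousSMul ℝ X] [OrderClosedTopology X] {z : ℕ → X} {y : X}
    (hz : Monotone z)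
    (hy : Tendsto (fun n : ℕ => (n : ℝ)⁻¹ • ∑ k ∈ Finset.range n, z k) atTop (𝓝 y)) (m : ℕ) :
    z m ≤ y := by
  -- Split the mean of `z k - z m` at `k = m`: the head is a fixed sum over `n`, hence null, and the
  -- tail is nonnegative.
  have hinv : Tendsto (fun n : ℕ => (n : ℝ)⁻¹ • ∑ k ∈ Finset.range m, (z k - z m)) atTop (𝓝 0) := by
    simpa using (tendsto_inv_atTop_nhds_zero_nat (𝕜 := ℝ)).smul_const
      (∑ k ∈ Finset.range m, (z k - z m))
  refine sub_nonneg.1 (le_of_tendsto_of_tendsto hinv (hy.sub_const (z m)) ?_)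
  filter_upwards [eventually_ge_atTop m, eventually_gt_atTop 0] with n hmn hn
  have hn' : (n : ℝ) ≠ 0 := Nat.cast_ne_zero.2 hn.ne'
  have hmean : (n : ℝ)⁻¹ • ∑ k ∈ Finset.range n, z k - z m
      = (n : ℝ)⁻¹ • ∑ k ∈ Finset.range n, (z k - z m) := by
    rw [Finset.sum_sub_distrib, Finset.sum_const, Finset.card_range, smul_sub,
      ← Nat.cast_smul_eq_nsmul ℝ, inv_smul_smul₀ hn']
  rw [hmean]
  refine smul_le_smul_of_nonneg_left ?_ (by positivity)
  rw [← Finset.sum_range_add_sum_Ico _ hmn]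
  refine le_add_of_nonneg_right (Finset.sum_nonneg fun k hk => sub_nonneg.2 (hz ?_))
  exact (Finset.mem_Ico.1 hk).1

/-- The Cesàro means of a monotone sequence are dominated by the sequence. -/
theorem Monotone.cesaro_le [Module ℝ X] [IsOrderedModule ℝ X] {z : ℕ → X} (hz : Monotone z)
    {n : ℕ} (hn : 0 < n) : (n : ℝ)⁻¹ • ∑ k ∈ Finset.range n, z k ≤ z n := by
  rw [inv_smul_le_iff_of_pos (Nat.cast_pos.2 hn), Nat.cast_smul_eq_nsmul]
  simpa using Finset.sum_le_card_nsmul (Finset.range n) z (z n)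
    fun k hk => hz (Finset.mem_range.1 hk).le

theorem HasLSBSP.exists_tendsto_of_monotone [TopologicalSpace X] [IsTopologicalAddGroup X]
    [Module ℝ X] [IsOrderedModule ℝ X] [ContinuousSMul ℝ X] [T2Space X] [IsLocallySolid X]
    (hX : HasLSBSP X) {x : ℕ → X} (hx : Monotone x)
    (hb : Bornology.IsVonNBounded ℝ (Set.range x)) : ∃ y, Tendsto x atTop (𝓝 y) := by
  have := IsLocallySolid.orderClosedTopology (X := X)
  obtain ⟨φ, hφ, y, hy⟩ := hX x hb
  have hz : Monotone (x ∘ φ) := hx.comp hφ.monotone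
  have hle : ∀ n, x (φ n) ≤ y := hz.le_of_tendsto_cesaro hy
  have hsub : Tendsto (fun n => y - x (φ n)) atTop (𝓝 0) := by
    refine IsLocallySolid.tendsto_zero_of_le (by simpa using hy.const_sub y)
      (.of_forall fun n => sub_nonneg.2 (hle n)) ?_
    filter_upwards [eventually_gt_atTop 0] with n hn
    exact sub_le_sub_left (hz.cesaro_le hn) y
  refine ⟨y, ?_⟩
  have hlub : ∀ n, x n ≤ y := fun n => (hx (hφ.id_le n)).trans (hle n)
  have hsub' : Tendsto (fun n => y - x n) atTop (𝓝 0) := by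
    rw [(IsLocallySolid.hasBasis_solid (X := X)).tendsto_right_iff]
    rintro U ⟨hU, hs⟩
    obtain ⟨k, hk⟩ := (hsub.eventually_mem hU).exists
    filter_upwards [eventually_ge_atTop (φ k)] with n hn
    refine hs hk ?_
    rw [abs_of_nonneg (sub_nonneg.2 (hlub n)), abs_of_nonneg (sub_nonneg.2 (hle k))]
    exact sub_le_sub_left (hx hn) y
  simpa using hsub'.const_sub y

/-- In a complete locally solid vector lattice with the Banach-Saks property, eventually bounded
monotone nets converge. -/
theorem HasLSBSP.exists_tendsto_net [UniformSpace X] [IsUniformAddGroup X]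
    [Module ℝ X] [IsOrderedModule ℝ X] [ContinuousSMul ℝ X] [T2Space X] [CompleteSpace X]
    [IsLocallySolid X] (hX : HasLSBSP X) {ι : Type*} [Preorder ι] [IsDirectedOrder ι]
    {f : ι → X} (hf : Monotone f) (a : ι)
    (hb : Bornology.IsVonNBounded ℝ (f '' Set.Ici a)) : ∃ y, Tendsto f atTop (𝓝 y) := by
  have : Nonempty ι := ⟨a⟩
  -- Increments from one index `d` suffice: `f p.2 - f p.1` is the difference of two of them.
  suffices hsmall : ∀ U ∈ 𝓝 (0 : X), ∃ d, ∀ e, d ≤ e → f e - f d ∈ U by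
    refine cauchy_map_iff_exists_tendsto.1 ?_
    refine cauchy_map_iff.2 ⟨inferInstance, ?_⟩
    rw [uniformity_eq_comap_nhds_zero, tendsto_comap_iff]
    intro U hU
    obtain ⟨V, hV, hVU⟩ := exists_nhds_half_neg hU
    obtain ⟨d, hd⟩ := hsmall V hV
    rw [mem_map]
    filter_upwards [prod_mem_prod (Ici_mem_atTop d) (Ici_mem_atTop d)] with p hp
    simpa using hVU _ (hd _ hp.2) _ (hd _ hp.1)
  by_contra! h
  obtain ⟨U, hU, hstep⟩ := h
  choose g hg hgU using hstep
  let s : ℕ → ι := fun n => g^[n] a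
  have hs : ∀ n, s (n + 1) = g (s n) := fun n => Function.iterate_succ_apply' g n a
  -- Starting the iteration at `a` keeps the sequence in the bounded tail.
  have hmono : Monotone s := monotone_nat_of_le_succ fun n => (hs n).symm ▸ hg (s n)
  obtain ⟨y, hy⟩ := hX.exists_tendsto_of_monotone (hf.comp hmono) (hb.subset (by
    rintro _ ⟨n, rfl⟩
    exact ⟨s n, hmono (Nat.zero_le n), rfl⟩))
  have hdiff : Tendsto (fun n => f (s (n + 1)) - f (s n)) atTop (𝓝 0) := by
    simpa using ((tendsto_add_atTop_iff_nat 1).2 hy).sub hy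
  obtain ⟨n, hn⟩ := (hdiff.eventually_mem hU).exists
  rw [hs] at hn
  exact hgU _ hn

end LocallySolid

theorem proposition2p7 {X : Type u} [AddCommGroup X] [Module ℝ X] [Lattice X]
    [IsOrderedAddMonoid X] [IsOrderedModule ℝ X]
    [UniformSpace X] [IsUniformAddGroup X] [ContinuousSMul ℝ X] [T2Space X] [CompleteSpace X]
    [IsLocallySolid X] [LocallyConvexSpace ℝ X]
    (hX : HasLSBSP X) :
    HasLebesgueProperty.{u, v} X ∧ HasLeviProperty X := by
  have := IsLocallySolid.orderClosedTopology (X := X)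
  constructor
  · intro ι _ _ _ x hx hglb
    obtain ⟨a⟩ := ‹Nonempty ι›
    -- Beyond `a` the negated net lies in `[-x a, 0]`.
    have hb : Bornology.IsVonNBounded ℝ ((fun i => -x i) '' Set.Ici a) := by
      refine (IsLocallySolid.isVonNBounded_Icc (x a)).neg.subset ?_
      rintro _ ⟨i, hi, rfl⟩
      simpa using And.intro (hx hi) (hglb.1 ⟨i, rfl⟩)
    obtain ⟨y, hy⟩ := hX.exists_tendsto_net hx.neg a hb
    have hlim : Tendsto x atTop (𝓝 (-y)) := by simpa using hy.neg
    rwa [(isGLB_of_tendsto_atTop hx hlim).unique hglb] at hlim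
  · intro D hne hpos hdir hbdd
    have : Nonempty D := hne.to_subtype
    have : IsDirectedOrder D := ⟨hdir.directed_val⟩
    obtain ⟨d⟩ := ‹Nonempty D›
    obtain ⟨y, hy⟩ := hX.exists_tendsto_net (f := ((↑) : D → X)) (fun _ _ h => h) d
      (hbdd.subset (by rintro _ ⟨e, -, rfl⟩; exact e.2))
    have hlub := isLUB_of_tendsto_atTop (Subtype.mono_coe (· ∈ D)) hy
    rw [Subtype.range_coe_subtype] at hlub
    exact ⟨y, hlub⟩
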